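/- Let $h\colon\mathbb R\to\mathbb R$ be a $2\pi$-periodic $C^1$-function, of class $C^2$ on $\mathbb R\setminus 2\pi\mathbb Z$, such that $h(0)=0$ and $$h(x)=|x|\Big(\log\Big|\log\frac{|x|}{e}\Big|\Big)^{-1/2},\qquad 0<|x|\le e^{-1}.$$ Let $\mathbb T$ be the unit circle in $\mathbb C$, let $g\colon\mathbb T\to\mathbb C$ be given by $g(e^{i\theta})=h(\theta)$, and let $f(z)=(z-1)g(z)$, $z\in\mathbb T$; then $f\in C^2(\mathbb T)$. Let $f^{[1]}$ and $f^{[2]}$ be the divided differences of $f$: for $z_0,z_1,z_2\in\mathbb T$, $f^{[1]}(z_0,z_1)=\frac{f(z_0)-f(z_1)}{z_0-z_1}$ if $z_0\ne z_1$ and $f^{[1]}(z_0,z_0)=\frac{d}{dz}f(z)|_{z=z_0}$; $f^{[2]}(z_0,z_1,z_2)=\frac{f^{[1]}(z_0,z_1)-f^{[1]}(z_1,z_2)}{z_0-z_2}$ if $z_0\ne z_2$ and $f^{[2]}(z_0,z_1,z_0)=\frac{d}{dz}f^{[1]}(z,z_1)|_{z=z_0}$, where derivatives are taken along $\mathbb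 T$. For a unitary operator $U$ on $\ell^2_N=\mathbb C^N$ with spectral decomposition $U=\sum_{i=1}^N z_iP_i$ ($P_i$ pairwise orthogonal rank one orthogonal projections) and operators $X,Y$ on $\ell^2_N$ put $$T^{U,U,U}_{f^{[2]}}(X,Y)=\sum_{i,j,k=1}^N f^{[2]}(z_i,z_k,z_j)\,P_iXP_kYP_j ,$$ which does not depend on the chosen decomposition. Let $\|\cdot\|_p$ be the Schatten $p$-norm. Then there is a constant $c>0$ such that for every integer $n\ge 3$ there are a self-adjoint operator $W_n$ on $\ell^2_{8n+4}$ with $\|W_n\|_2\le 1$ and a unitary operator $U_n$ on $\ell^2_{8n+4}$ such that $$\big\|T^{U_n,U_n,U_n}_{f^{[2]}}(W_nU_n,W_nU_n)\big\|_1\ \ge\ c\,(\log n)^{1/2}.$$ -/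

import Mathlib

noncomputable section

namespace PellerUnitary

section Operators

variable {E : Type*} [NormedAddCommGroup E] [InnerProductSpace ℂ E] [FiniteDimensional ℂ E]

/-- The Schatten `p`-norm `(∑ s_i(A) ^ p) ^ (1 / p)`, `1 ≤ p < ∞`, of an operator on a
finite-dimensional Hilbert space, where `s_i(A)` are its singular values. -/
def schattenNorm (p : ℝ) (A : E →L[ℂ] E) : ℝ :=
  (∑ i ∈ Finset.range (Module.finrank ℂ E), (A : E →ₗ[ℂ] E).singularValues i ^ p) ^ (1 / p)

/-- The orthogonal projection onto the eigenspace of `U` for `z`. -/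
def spectralProj (U : E →L[ℂ] E) (z : ℂ) : E →L[ℂ] E :=
  (Module.End.eigenspace (U : E →ₗ[ℂ] E) z).starProjection

/-- The triple operator integral `T_ψ^{U₀,U₁,U₂}(X, Y)` of normal operators `U₀, U₁, U₂`, as a sum
over their spectra. `tripleOperatorIntegral_eq` below expresses it through arbitrary
orthonormal bases of eigenvectors. -/
def tripleOperatorIntegral (ψ : ℂ → ℂ → ℂ → ℂ) (U₀ U₁ U₂ X Y : E →L[ℂ] E) : E →L[ℂ] E :=
  ∑ z₀ : Module.End.Eigenvalues (U₀ : E →ₗ[ℂ] E),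
    ∑ z₁ : Module.End.Eigenvalues (U₁ : E →ₗ[ℂ] E),
      ∑ z₂ : Module.End.Eigenvalues (U₂ : E →ₗ[ℂ] E),
        ψ z₀ z₁ z₂ • (spectralProj U₀ z₀ * X * spectralProj U₁ z₁ * Y * spectralProj U₂ z₂)

/-- The orthogonal projection onto the line spanned by `v`. -/
def lineProj (v : E) : E →L[ℂ] E :=
  (Submodule.span ℂ {v}).starProjection

theorem spectralProj_eq {ι : Type*} [Fintype ι] (U : E →L[ℂ] E) (b : OrthonormalBasis ι ℂ E)
    (z : ι → ℂ) (hb : ∀ i, U (b i) = z i • b i) (w : ℂ) :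
    spectralProj U w = ∑ i, if z i = w then lineProj (b i) else 0 := by
  classical
  have key : ∀ j, spectralProj U w (b j)
      = (∑ i, if z i = w then lineProj (b i) else 0) (b j) := by
    intro j
    have hR : (∑ i, if z i = w then lineProj (b i) else 0) (b j)
        = if z j = w then b j else 0 := by
      rw [sum_apply, Finset.sum_eq_single j]
      · split_ifs
        · exact Submodule.starProjection_eq_self_iff.2 (Submodule.mem_span_singleton_self _)
        · rfl
      · intro i _ hij
        split_ifs
        · rw [lineProj, Submodule.starProjection_unit_singleton ℂ (b.norm_eq_one i),
            b.inner_eq_ite, if_neg hij, zero_smul]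
        · rfl
      · simp
    rw [hR]
    split_ifs with h
    · refine Submodule.starProjection_eq_self_iff.2 ?_
      rw [Module.End.mem_eigenspace_iff]
      simpa [h] using hb j
    · refine (Submodule.starProjection_apply_eq_zero_iff _).2 ?_
      rw [Submodule.mem_orthogonal']
      intro v hv
      rw [Module.End.mem_eigenspace_iff] at hv
      have hv' : U v = w • v := hv
      have h1 : U v = ∑ i, (inner ℂ (b i) v * z i) • b i := by
        conv_lhs => rw [← b.sum_repr' v]
        simp [map_sum, hb, smul_smul]
      have h2 : inner ℂ (b j) (U v) = inner ℂ (b j) v * z j := by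
        rw [h1, b.orthonormal.inner_right_fintype]
      rw [hv', inner_smul_right] at h2
      have h3 : (w - z j) * inner ℂ (b j) v = 0 := by linear_combination h2
      rcases mul_eq_zero.1 h3 with h4 | h4
      · exact absurd (sub_eq_zero.1 h4).symm h
      · exact h4
  ext1 v
  rw [← b.sum_repr' v]
  simp only [map_sum, map_smul, key]

theorem sum_spectralProj {ι : Type*} [Fintype ι] {M : Type*} [AddCommMonoid M]
    (U : E →L[ℂ] E) (b : OrthonormalBasis ι ℂ E)
    (z : ι → ℂ) (hb : ∀ i, U (b i) = z i • b i) (G : ℂ → (E →L[ℂ] E) →+ M) :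
    ∑ w : Module.End.Eigenvalues (U : E →ₗ[ℂ] E), G w (spectralProj U w)
      = ∑ i, G (z i) (lineProj (b i)) := by
  classical
  simp only [spectralProj_eq U b z hb, map_sum]
  rw [Finset.sum_comm]
  refine Finset.sum_congr rfl fun i _ => ?_
  have hz : Module.End.HasEigenvalue (U : E →ₗ[ℂ] E) (z i) :=
    Module.End.hasEigenvalue_of_hasEigenvector (x := b i)
      ⟨Module.End.mem_eigenspace_iff.2 (hb i), b.orthonormal.ne_zero i⟩
  let w₀ : Module.End.Eigenvalues (U : E →ₗ[ℂ] E) := ⟨z i, hz⟩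
  have hw₀ : Module.End.UnifEigenvalues.val _ 1 w₀ = z i := rfl
  rw [Finset.sum_eq_single_of_mem w₀ (Finset.mem_univ _), hw₀, if_pos rfl]
  intro w _ hw
  rw [if_neg fun hzw => hw (Subtype.ext hzw.symm), map_zero]

/-- `T_ψ^{U₀,U₁,U₂}(X, Y) = ∑ ψ(z_i, z_k, z_j) P_i X P_k Y P_j` for any orthonormal bases of
eigenvectors of `U₀, U₁, U₂`. -/
theorem tripleOperatorIntegral_eq {ι₀ ι₁ ι₂ : Type*} [Fintype ι₀] [Fintype ι₁] [Fintype ι₂]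
    (ψ : ℂ → ℂ → ℂ → ℂ) (U₀ U₁ U₂ X Y : E →L[ℂ] E)
    (b₀ : OrthonormalBasis ι₀ ℂ E) (z₀ : ι₀ → ℂ) (h₀ : ∀ i, U₀ (b₀ i) = z₀ i • b₀ i)
    (b₁ : OrthonormalBasis ι₁ ℂ E) (z₁ : ι₁ → ℂ) (h₁ : ∀ i, U₁ (b₁ i) = z₁ i • b₁ i)
    (b₂ : OrthonormalBasis ι₂ ℂ E) (z₂ : ι₂ → ℂ) (h₂ : ∀ i, U₂ (b₂ i) = z₂ i • b₂ i) :
    tripleOperatorIntegral ψ U₀ U₁ U₂ X Y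
      = ∑ i, ∑ k, ∑ j, ψ (z₀ i) (z₁ k) (z₂ j) •
          (lineProj (b₀ i) * X * lineProj (b₁ k) * Y * lineProj (b₂ j)) := by
  let L : (E →L[ℂ] E) → (E →L[ℂ] E) → ℂ → (E →L[ℂ] E) →+ (E →L[ℂ] E) := fun A B c =>
    { toFun := fun P => c • (A * P * B)
      map_zero' := by simp
      map_add' := by intro P Q; simp [mul_add, add_mul] }
  have e2 : ∀ (a c : ℂ) (A : E →L[ℂ] E),
      ∑ w : Module.End.Eigenvalues (U₂ : E →ₗ[ℂ] E), ψ a c w • (A * spectralProj U₂ w)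
        = ∑ j, ψ a c (z₂ j) • (A * lineProj (b₂ j)) := by
    intro a c A
    simpa [L] using sum_spectralProj U₂ b₂ z₂ h₂ (fun w => L A 1 (ψ a c w))
  have e1 : ∀ (a : ℂ) (A : E →L[ℂ] E),
      ∑ w : Module.End.Eigenvalues (U₁ : E →ₗ[ℂ] E), ∑ j,
          ψ a w (z₂ j) • (A * X * spectralProj U₁ w * Y * lineProj (b₂ j))
        = ∑ k, ∑ j, ψ a (z₁ k) (z₂ j) • (A * X * lineProj (b₁ k) * Y * lineProj (b₂ j)) := by
    intro a A
    simpa [L, mul_assoc] using sum_spectralProj U₁ b₁ z₁ h₁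
      (fun w => ∑ j, L (A * X) (Y * lineProj (b₂ j)) (ψ a w (z₂ j)))
  have e0 : ∑ w : Module.End.Eigenvalues (U₀ : E →ₗ[ℂ] E), ∑ k, ∑ j,
          ψ w (z₁ k) (z₂ j) •
            (spectralProj U₀ w * X * lineProj (b₁ k) * Y * lineProj (b₂ j))
        = ∑ i, ∑ k, ∑ j, ψ (z₀ i) (z₁ k) (z₂ j) •
            (lineProj (b₀ i) * X * lineProj (b₁ k) * Y * lineProj (b₂ j)) := by
    simpa [L, mul_assoc] using sum_spectralProj U₀ b₀ z₀ h₀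
      (fun w => ∑ k, ∑ j, L 1 (X * lineProj (b₁ k) * Y * lineProj (b₂ j)) (ψ w (z₁ k) (z₂ j)))
  rw [← e0, tripleOperatorIntegral]
  simp only [e2, e1]

end Operators

/-- The unit circle `𝕋` in `ℂ`. -/
abbrev unitCircle : Set ℂ := Metric.sphere 0 1

/-- The first divided difference `f^{[1]}` on `𝕋²`; derivatives are taken along `𝕋`, i.e. as limits
of `(f w - f z) / (w - z)` with `w ∈ 𝕋`, `w → z`. -/
def dividedDiff₁ (f : ℂ → ℂ) (z₀ z₁ : ℂ) : ℂ :=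
  if z₀ = z₁ then derivWithin f unitCircle z₀ else (f z₀ - f z₁) / (z₀ - z₁)

/-- The second divided difference `f^{[2]}` on `𝕋³`. -/
def dividedDiff₂ (f : ℂ → ℂ) (z₀ z₁ z₂ : ℂ) : ℂ :=
  if z₀ = z₂ then derivWithin (fun z => dividedDiff₁ f z z₁) unitCircle z₀
  else (dividedDiff₁ f z₀ z₁ - dividedDiff₁ f z₁ z₂) / (z₀ - z₂)

/-- The function `|x| (log |log (|x| / e)|) ^ (-1/2)`, with value `0` at `0`. -/
def h₀ (x : ℝ) : ℝ :=
  if x = 0 then 0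
  else |x| * (Real.log |Real.log (|x| / Real.exp 1)|) ^ (-(1 / 2) : ℝ)

/-- `h` is a `2π`-periodic `C¹` extension of the restriction of `h₀` to `[-e⁻¹, e⁻¹]`, of class
`C²` away from `2πℤ` (which makes `z ↦ (z - 1) g(z)`, `g(e^{iθ}) = h(θ)`, of class `C²` on `𝕋`). -/
structure IsAdmissible (h : ℝ → ℝ) : Prop where
  eq_h₀ : ∀ x ∈ Set.Icc (-Real.exp (-1)) (Real.exp (-1)), h x = h₀ x
  periodic : Function.Periodic h (2 * Real.pi)
  contDiff_one : ContDiff ℝ 1 h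
  contDiffOn_two : ContDiffOn ℝ 2 h {x | ∀ k : ℤ, x ≠ k * (2 * Real.pi)}

/-- For a `2π`-periodic `h`, the function on `𝕋` with `g(e^{iθ}) = h(θ)`. -/
def circleFun (h : ℝ → ℝ) (z : ℂ) : ℂ := (h z.arg : ℂ)

theorem circleFun_exp {h : ℝ → ℝ} (hh : Function.Periodic h (2 * Real.pi)) (θ : ℝ) :
    circleFun h (Complex.exp (θ * Complex.I)) = (h θ : ℂ) := by
  rw [circleFun, Complex.arg_exp_mul_I, toIocMod, hh.sub_zsmul_eq]

/-- The function `f(z) = (z - 1) g(z)`, where `g(e^{iθ}) = h(θ)`. -/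
def fFun (h : ℝ → ℝ) (z : ℂ) : ℂ := (z - 1) * circleFun h z

end PellerUnitary

end

/-! Give `U` the simple eigenvalue `1` with eigenvector `e` and eigenvalues `e^{iα_k}`,
`e^{-iα_l}` (`k, l < n`, `α_k = e^{-(k+1)}`), and let `W = e ⊗ u + u ⊗ e` for a vector `u ⊥ e`
spread evenly over the other eigenvectors. Since `f(z) = (z - 1) g(z)`, the entries of the triple
operator integral between the eigenvectors for `e^{iα_k}` and `e^{-iα_l}` are, up to a scalar of
size `1 / n`, the divided differences `g^{[1]}(e^{iα_k}, e^{-iα_l})`. Because `g(e^{ix})` is an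
even function of `x` and the `α_k` decrease geometrically, these equal, up to diagonal unitary
factors, a real antisymmetric matrix whose entries above the diagonal are at least
`(log n)^{-1/2}` up to a constant. Pairing it with the matrix `1 / (l - k)`, whose operator norm is
at most `π` by Hilbert's inequality, gives at least a constant times `(log n)^{-1/2} · n log n`, and
by trace duality this pairing is at most `4 π n` times the trace norm. -/

noncomputable section

namespace PellerUnitary

section Compression

open scoped Matrix.Norms.L2Operator

variable {𝕜 F G κ ι : Type*} [RCLike 𝕜] [NormedAddCommGroup F] [InnerProductSpace 𝕜 F]
  [NormedAddCommGroup G] [InnerProductSpace 𝕜 G] [Fintype κ] [Fintype ι]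

theorem norm_sum_smul_of_orthonormal {v : ι → F} (hv : Orthonormal 𝕜 v)
    (x : EuclideanSpace 𝕜 ι) : ‖∑ i, x i • v i‖ = ‖x‖ := by
  rw [← sq_eq_sq₀ (norm_nonneg _) (norm_nonneg _), @norm_sq_eq_re_inner 𝕜, hv.inner_sum,
    EuclideanSpace.norm_sq_eq, map_sum]
  exact Finset.sum_congr rfl fun i _ => by
    rw [RCLike.conj_mul, ← RCLike.ofReal_pow, RCLike.ofReal_re]

theorem l2_opNorm_compression_le [DecidableEq ι] {u : κ → G} {v : ι → F} (hu : Orthonormal 𝕜 u)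
    (hv : Orthonormal 𝕜 v) (T : F →L[𝕜] G) :
    ‖(Matrix.of fun k i => inner 𝕜 (u k) (T (v i)) : Matrix κ ι 𝕜)‖ ≤ ‖T‖ := by
  rw [Matrix.l2_opNorm_def]
  refine ContinuousLinearMap.opNorm_le_bound _ (norm_nonneg _) fun x => ?_
  have hcoord (k : κ) : Matrix.toEuclideanLin (Matrix.of fun k i => inner 𝕜 (u k) (T (v i))) x k
      = inner 𝕜 (u k) (T (∑ i, x i • v i)) := by
    simp [Matrix.ofLp_toLpLin, Matrix.mulVec, dotProduct, inner_sum, inner_smul_right, mul_comm]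
  calc _ ≤ ‖T (∑ i, x i • v i)‖ := by
        rw [← sq_le_sq₀ (norm_nonneg _) (norm_nonneg _), EuclideanSpace.norm_sq_eq]
        refine le_trans (le_of_eq ?_) (hu.sum_inner_products_le _ (s := Finset.univ))
        exact Finset.sum_congr rfl fun k _ => congrArg (‖·‖ ^ 2) (hcoord k)
    _ ≤ ‖T‖ * ‖x‖ := norm_sum_smul_of_orthonormal hv x ▸ T.le_opNorm _

end Compression

section HilbertMatrix

open MeasureTheory AddCircle
open scoped Matrix.Norms.L2Operator ENNReal Real

/-- The multiplication operator on `L²(μ)` with symbol `φ ∈ L^∞(μ)`. -/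
def mulLp {α : Type*} [MeasurableSpace α] {μ : Measure α} (φ : Lp ℂ ∞ μ) :
    Lp ℂ 2 μ →L[ℂ] Lp ℂ 2 μ :=
  (ContinuousLinearMap.lsmul ℂ ℂ).holderL μ ∞ 2 2 φ

theorem norm_mulLp_le {α : Type*} [MeasurableSpace α] {μ : Measure α} (φ : Lp ℂ ∞ μ) :
    ‖mulLp φ‖ ≤ ‖φ‖ := by
  refine ContinuousLinearMap.opNorm_le_bound _ (norm_nonneg _) fun f => ?_
  exact Lp.norm_smul_le _ _

theorem inner_fourierLp_mulLp_fourierLp {T : ℝ} [Fact (0 < T)]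
    (φ : Lp ℂ ∞ (haarAddCircle (T := T))) (m j : ℤ) :
    inner ℂ (fourierLp (T := T) 2 m) (mulLp φ (fourierLp (T := T) 2 j))
      = fourierCoeff φ (m - j) := by
  rw [L2.inner_def, fourierCoeff]
  refine integral_congr_ae ?_
  filter_upwards [coeFn_fourierLp (T := T) 2 m, coeFn_fourierLp (T := T) 2 j,
    Lp.coeFn_lpSMul (r := 2) φ (fourierLp (T := T) 2 j)] with t hm hj hφ
  change inner ℂ _ ((φ • fourierLp (T := T) 2 j : Lp ℂ 2 haarAddCircle) t) = _
  rw [hφ, Pi.smul_apply', hm, hj, RCLike.inner_apply, ← fourier_neg, neg_sub, sub_eq_add_neg,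
    fourier_add, smul_eq_mul, smul_eq_mul]
  ring

theorem l2_opNorm_toeplitz_le {T : ℝ} [Fact (0 < T)] {κ : Type*} [Fintype κ] [DecidableEq κ]
    {a : κ → ℤ} (ha : Function.Injective a) {f : AddCircle T → ℂ}
    (hf : AEStronglyMeasurable f haarAddCircle) {C : ℝ} (hC : ∀ t, ‖f t‖ ≤ C) :
    ‖(Matrix.of fun k l => fourierCoeff f (a k - a l) : Matrix κ κ ℂ)‖ ≤ C := by
  have hmem : MemLp f ∞ haarAddCircle := memLp_top_of_bound hf C (.of_forall hC)
  have hC0 : 0 ≤ C := (norm_nonneg _).trans (hC 0)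
  have hnorm : ‖hmem.toLp f‖ ≤ C := by
    have hae : ∀ᵐ t ∂haarAddCircle, ‖hmem.toLp f t‖ ≤ C := by
      filter_upwards [hmem.coeFn_toLp] with t ht using ht ▸ hC t
    simpa using Lp.norm_le_of_ae_bound hC0 hae
  have horth : Orthonormal ℂ fun k => fourierLp (T := T) 2 (a k) := orthonormal_fourier.comp a ha
  simp only [← fourierCoeff_congr_ae hmem.coeFn_toLp, ← inner_fourierLp_mulLp_fourierLp]
  exact (l2_opNorm_compression_le horth horth _).trans ((norm_mulLp_le _).trans hnorm)

/-- The matrix of Hilbert's inequality, with zero diagonal since `0⁻¹ = 0`. -/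
def hilbertMatrix (n : ℕ) : Matrix (Fin n) (Fin n) ℂ :=
  Matrix.of fun k l => ((l : ℂ) - k)⁻¹

theorem abs_periodizedBernoulli_one_le (t : UnitAddCircle) : |periodizedBernoulli 1 t| ≤ 1 / 2 := by
  obtain ⟨x, hx, rfl⟩ := (AddCircle.coe_image_Ico_eq (1 : ℝ) 0).symm ▸ Set.mem_univ t
  rw [zero_add] at hx
  rw [periodizedBernoulli, AddCircle.liftIco_zero_coe_apply hx, bernoulliFun_one, abs_le]
  constructor <;> linarith [hx.1, hx.2]

theorem measurable_periodizedBernoulli (k : ℕ) : Measurable (periodizedBernoulli k) :=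
  ((Polynomial.continuous _).measurable.comp measurable_subtype_coe).comp
    (AddCircle.measurableEquivIco 1 0).measurable

theorem l2_opNorm_hilbertMatrix_le (n : ℕ) : ‖hilbertMatrix n‖ ≤ π := by
  have hmeas : Measurable fun t => (periodizedBernoulli 1 t : ℂ) :=
    Complex.measurable_ofReal.comp (measurable_periodizedBernoulli 1)
  have hbound (t : UnitAddCircle) : ‖(periodizedBernoulli 1 t : ℂ)‖ ≤ 1 / 2 := by
    simpa using abs_periodizedBernoulli_one_le t
  have hinj : Function.Injective fun k : Fin n => ((k : ℕ) : ℤ) :=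
    Nat.cast_injective.comp Fin.val_injective
  have hentry : hilbertMatrix n = (2 * π * Complex.I : ℂ) • Matrix.of fun k l : Fin n =>
      fourierCoeff (fun t : UnitAddCircle => (periodizedBernoulli 1 t : ℂ))
        ((k : ℤ) - (l : ℤ)) := by
    ext k l
    have hcoeff := fourierCoeff_bernoulli_eq one_ne_zero ((k : ℤ) - (l : ℤ))
    have hflip : (l - k : ℂ)⁻¹ = -(k - l : ℂ)⁻¹ := by rw [← inv_neg, neg_sub]
    rw [Function.comp_def] at hcoeff
    rw [Matrix.smul_apply, Matrix.of_apply, hcoeff, hilbertMatrix, Matrix.of_apply, smul_eq_mul,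
      hflip, pow_one, Nat.factorial_one, Nat.cast_one, neg_div, one_div, mul_inv (_ * _), mul_neg,
      mul_inv_cancel_left₀ Complex.two_pi_I_ne_zero]
    push_cast
    rfl
  calc ‖hilbertMatrix n‖ ≤ ‖(2 * π * Complex.I : ℂ)‖ * (1 / 2) := by
        rw [hentry, norm_smul]
        exact mul_le_mul_of_nonneg_left
          (l2_opNorm_toeplitz_le hinj hmeas.aestronglyMeasurable hbound) (norm_nonneg _)
    _ = π := by
      rw [norm_mul, norm_mul, Complex.norm_I, Complex.norm_real, Complex.norm_two,
        Real.norm_of_nonneg Real.pi_pos.le]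
      ring

end HilbertMatrix

section SchattenNorms

open scoped Matrix.Norms.L2Operator

variable {E : Type*} [NormedAddCommGroup E] [InnerProductSpace ℂ E] [FiniteDimensional ℂ E]

theorem schattenNorm_nonneg (p : ℝ) (A : E →L[ℂ] E) : 0 ≤ schattenNorm p A :=
  Real.rpow_nonneg (Finset.sum_nonneg fun i _ =>
    Real.rpow_nonneg (LinearMap.singularValues_nonneg _ i) p) _

theorem exists_schattenNorm_one_eq_sum_norm (A : E →L[ℂ] E) :
    ∃ b : OrthonormalBasis (Fin (Module.finrank ℂ E)) ℂ E, schattenNorm 1 A = ∑ r, ‖A (b r)‖ := by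
  set S := (A : E →ₗ[ℂ] E)
  have hS := S.isSymmetric_adjoint_comp_self
  refine ⟨hS.eigenvectorBasis rfl, ?_⟩
  simp only [schattenNorm, Real.rpow_one, div_one]
  rw [Finset.sum_range]
  refine Finset.sum_congr rfl fun r _ => ?_
  set v := hS.eigenvectorBasis rfl r
  have heigen : hS.eigenvalues rfl r = ‖S v‖ ^ 2 := by
    have hinner : inner ℂ v ((S.adjoint ∘ₗ S) v) = (hS.eigenvalues rfl r : ℂ) := by
      rw [hS.apply_eigenvectorBasis, inner_smul_right, inner_self_eq_norm_sq_to_K,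
        OrthonormalBasis.norm_eq_one]
      simp
    rw [LinearMap.comp_apply, LinearMap.adjoint_inner_right, inner_self_eq_norm_sq_to_K] at hinner
    exact Complex.ofReal_injective (hinner.symm.trans (Complex.ofReal_pow _ _).symm)
  rw [S.singularValues_fin rfl, heigen, Real.sqrt_sq (norm_nonneg _)]
  rfl

theorem schattenNorm_two_eq_sqrt_sum {ι : Type*} [Fintype ι] (b : OrthonormalBasis ι ℂ E)
    (A : E →L[ℂ] E) : schattenNorm 2 A = √(∑ i, ‖A (b i)‖ ^ 2) := by
  set S := (A : E →ₗ[ℂ] E)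
  have hS := S.isSymmetric_adjoint_comp_self
  have hsq (r : Fin (Module.finrank ℂ E)) :
      S.singularValues r ^ (2 : ℝ) = hS.eigenvalues rfl r := by
    rw [← S.sq_singularValues_fin rfl, ← Real.rpow_natCast, Nat.cast_ofNat]
  rw [schattenNorm, ← Real.sqrt_eq_rpow, Finset.sum_range, Finset.sum_congr rfl fun r _ => hsq r,
    ← hS.re_trace_eq_sum_eigenvalues, LinearMap.trace_eq_sum_inner _ b, map_sum]
  congr! 2 with i
  rw [LinearMap.comp_apply, LinearMap.adjoint_inner_right, inner_self_eq_norm_sq]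
  rfl

theorem norm_dotProduct_mulVec_le {𝕜 κ ι : Type*} [RCLike 𝕜] [Fintype κ] [Fintype ι]
    [DecidableEq ι] (K : Matrix κ ι 𝕜) (x : κ → 𝕜) (y : ι → 𝕜) :
    ‖x ⬝ᵥ K.mulVec y‖ ≤ ‖K‖ * √(∑ k, ‖x k‖ ^ 2) * √(∑ i, ‖y i‖ ^ 2) := by
  calc ‖x ⬝ᵥ K.mulVec y‖
      = ‖inner 𝕜 (WithLp.toLp 2 (star x)) (WithLp.toLp 2 (K.mulVec y))‖ := by
        rw [EuclideanSpace.inner_toLp_toLp, star_star, dotProduct_comm]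
    _ ≤ ‖WithLp.toLp 2 (star x)‖ * (‖K‖ * ‖WithLp.toLp 2 y‖) :=
        (norm_inner_le_norm _ _).trans <|
          mul_le_mul_of_nonneg_left (K.l2_opNorm_mulVec (WithLp.toLp 2 y)) (norm_nonneg _)
    _ = _ := by
        simp only [EuclideanSpace.norm_eq, Pi.star_apply, norm_star]
        ring

theorem norm_sum_mul_inner_le {κ ι : Type*} [Fintype κ] [Fintype ι] [DecidableEq ι]
    {p : κ → E} {q : ι → E} (hp : Orthonormal ℂ p) (hq : Orthonormal ℂ q) (K : Matrix κ ι ℂ)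
    (A : E →L[ℂ] E) :
    ‖∑ k, ∑ l, K k l * inner ℂ (p k) (A (q l))‖ ≤ ‖K‖ * schattenNorm 1 A := by
  obtain ⟨b, hb⟩ := exists_schattenNorm_one_eq_sum_norm A
  have hexpand : ∑ k, ∑ l, K k l * inner ℂ (p k) (A (q l))
      = ∑ r, (fun k => inner ℂ (p k) (A (b r))) ⬝ᵥ K.mulVec fun l => inner ℂ (b r) (q l) := by
    have hentry (k : κ) (l : ι) : inner ℂ (p k) (A (q l))
        = ∑ r, inner ℂ (b r) (q l) * inner ℂ (p k) (A (b r)) := by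
      conv_lhs => rw [← b.sum_repr' (q l)]
      simp only [map_sum, map_smul, inner_sum, inner_smul_right]
    simp only [hentry, dotProduct, Matrix.mulVec, Finset.mul_sum]
    rw [Finset.sum_comm_cycle]
    refine Finset.sum_congr rfl fun r _ => Finset.sum_congr rfl fun k _ =>
      Finset.sum_congr rfl fun l _ => ?_
    ring
  have hbessel (r) : √(∑ k, ‖inner ℂ (p k) (A (b r))‖ ^ 2) ≤ ‖A (b r)‖ :=
    Real.sqrt_le_iff.2 ⟨norm_nonneg _, hp.sum_inner_products_le _⟩
  have hbessel' (r) : √(∑ l, ‖inner ℂ (b r) (q l)‖ ^ 2) ≤ 1 := by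
    simp only [norm_inner_symm (b r)]
    exact Real.sqrt_le_one.2 <| (hq.sum_inner_products_le _).trans_eq (by simp)
  rw [hexpand, hb, Finset.mul_sum]
  refine norm_sum_le_of_le _ fun r _ => (norm_dotProduct_mulVec_le _ _ _).trans ?_
  calc _ ≤ ‖K‖ * ‖A (b r)‖ * 1 := by gcongr; exacts [hbessel r, hbessel' r]
    _ = ‖K‖ * ‖A (b r)‖ := mul_one _

/-- The rank two self-adjoint operator `e ⊗ u + u ⊗ e`. -/
def symmRankTwo (e u : E) : E →L[ℂ] E :=
  InnerProductSpace.rankOne ℂ e u + InnerProductSpace.rankOne ℂ u e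

theorem isSelfAdjoint_symmRankTwo {H : Type*} [NormedAddCommGroup H] [InnerProductSpace ℂ H]
    [CompleteSpace H] (e u : H) : IsSelfAdjoint (symmRankTwo e u) := by
  rw [ContinuousLinearMap.isSelfAdjoint_iff', symmRankTwo, map_add,
    InnerProductSpace.adjoint_rankOne, InnerProductSpace.adjoint_rankOne, add_comm]

theorem schattenNorm_two_symmRankTwo {e u : E} (h : inner ℂ e u = 0) :
    schattenNorm 2 (symmRankTwo e u) = √2 * (‖e‖ * ‖u‖) := by
  let b := stdOrthonormalBasis ℂ E
  have hpyth (i) : ‖symmRankTwo e u (b i)‖ ^ 2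
      = ‖inner ℂ (b i) u‖ ^ 2 * ‖e‖ ^ 2 + ‖inner ℂ (b i) e‖ ^ 2 * ‖u‖ ^ 2 := by
    have horth : inner ℂ (inner ℂ u (b i) • e) (inner ℂ e (b i) • u) = 0 := by
      rw [inner_smul_left, inner_smul_right, h, mul_zero, mul_zero]
    rw [symmRankTwo, add_apply, InnerProductSpace.rankOne_apply,
      InnerProductSpace.rankOne_apply, sq,
      norm_add_sq_eq_norm_sq_add_norm_sq_of_inner_eq_zero _ _ horth, norm_smul, norm_smul,
      norm_inner_symm, norm_inner_symm e]
    ring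
  rw [schattenNorm_two_eq_sqrt_sum b]
  simp only [hpyth, Finset.sum_add_distrib, ← Finset.sum_mul, b.sum_sq_norm_inner_right]
  rw [show ‖u‖ ^ 2 * ‖e‖ ^ 2 + ‖e‖ ^ 2 * ‖u‖ ^ 2 = 2 * (‖e‖ * ‖u‖) ^ 2 by ring,
    Real.sqrt_mul (by norm_num), Real.sqrt_sq (by positivity)]

end SchattenNorms

section TripleOperatorIntegral

open scoped Matrix.Norms.L2Operator

variable {E : Type*} [NormedAddCommGroup E] [InnerProductSpace ℂ E] [FiniteDimensional ℂ E]

theorem inner_tripleOperatorIntegral {ι : Type*} [Fintype ι] (ψ : ℂ → ℂ → ℂ → ℂ)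
    {U : E →L[ℂ] E} (b : OrthonormalBasis ι ℂ E) {z : ι → ℂ} (hU : ∀ i, U (b i) = z i • b i)
    (X Y : E →L[ℂ] E) (i j : ι) :
    inner ℂ (b i) (tripleOperatorIntegral ψ U U U X Y (b j))
      = ∑ k, ψ (z i) (z k) (z j) * inner ℂ (b i) (X (b k)) * inner ℂ (b k) (Y (b j)) := by
  classical
  have hproj (m : ι) (x : E) : lineProj (b m) x = inner ℂ (b m) x • b m :=
    Submodule.starProjection_unit_singleton ℂ (b.norm_eq_one m) x
  simp only [tripleOperatorIntegral_eq ψ U U U X Y b z hU b z hU b z hU, sum_apply, inner_sum,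
    smul_apply, ContinuousLinearMap.mul_def, ContinuousLinearMap.comp_apply, hproj, map_smul,
    inner_smul_right, b.inner_eq_ite]
  rw [Finset.sum_eq_single i, Finset.sum_comm, Finset.sum_eq_single j]
  · refine Finset.sum_congr rfl fun k _ => ?_
    simp only [if_true]
    ring
  all_goals simp +contextual [eq_comm]

theorem inner_tripleOperatorIntegral_symmRankTwo_mul {ι : Type*} [Fintype ι] (ψ : ℂ → ℂ → ℂ → ℂ)
    {U : E →L[ℂ] E} (b : OrthonormalBasis ι ℂ E) {z : ι → ℂ} (hU : ∀ i, U (b i) = z i • b i)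
    (u : E) {o i j : ι} (hi : i ≠ o) (hj : j ≠ o) :
    inner ℂ (b i) (tripleOperatorIntegral ψ U U U (symmRankTwo (b o) u * U)
        (symmRankTwo (b o) u * U) (b j))
      = ψ (z i) (z o) (z j) * z o * z j * (inner ℂ (b i) u * inner ℂ u (b j)) := by
  classical
  have hW (k l : ι) : inner ℂ (b k) ((symmRankTwo (b o) u * U) (b l))
      = z l * (inner ℂ u (b l) * (if k = o then 1 else 0)
        + (if o = l then 1 else 0) * inner ℂ (b k) u) := by
    simp only [symmRankTwo, ContinuousLinearMap.mul_def, ContinuousLinearMap.comp_apply, hU,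
      map_smul, add_apply, InnerProductSpace.rankOne_apply, inner_smul_right, inner_add_right,
      b.inner_eq_ite]
  rw [inner_tripleOperatorIntegral ψ b hU, Finset.sum_eq_single o]
  · simp only [hW, if_neg hi, if_neg hj.symm, if_true]
    ring
  · intro k _ hk
    simp only [hW, if_neg hi, if_neg hk.symm]
    ring
  · simp

theorem exists_mem_unitary_apply_eq_smul {ι : Type*} [Fintype ι] (b : OrthonormalBasis ι ℂ E)
    {z : ι → ℂ} (hz : ∀ i, ‖z i‖ = 1) :
    ∃ U ∈ unitary (E →L[ℂ] E), ∀ i, U (b i) = z i • b i := by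
  classical
  let L : E →ₗ[ℂ] E := b.toBasis.constr ℂ fun i => z i • b i
  have hL (i : ι) : L (b i) = z i • b i := by
    rw [← b.coe_toBasis, Module.Basis.constr_basis, b.coe_toBasis]
  have horth : Orthonormal ℂ (L ∘ b.toBasis) := by
    rw [orthonormal_iff_ite]
    intro i j
    simp only [Function.comp_apply, b.coe_toBasis, hL, inner_smul_left, inner_smul_right,
      b.inner_eq_ite]
    split_ifs with hij
    · rw [hij, mul_one, Complex.mul_conj', hz, Complex.ofReal_one, one_pow]
    · rw [mul_zero, mul_zero]
  let V : E →ₗᵢ[ℂ] E := L.isometryOfOrthonormal (b.coe_toBasis ▸ b.orthonormal) horth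
  exact ⟨_, (Unitary.linearIsometryEquiv.symm (V.toLinearIsometryEquiv rfl)).2, hL⟩

theorem exists_unitary_eigenbasis {τ : Type*} [Fintype τ]
    (hcard : Fintype.card τ ≤ Module.finrank ℂ E) {z : τ → ℂ} (hz : ∀ t, ‖z t‖ = 1) :
    ∃ (b : OrthonormalBasis (Fin (Module.finrank ℂ E)) ℂ E) (w : Fin (Module.finrank ℂ E) → ℂ)
      (e : τ ↪ Fin (Module.finrank ℂ E)), (∀ t, w (e t) = z t) ∧
      ∃ U ∈ unitary (E →L[ℂ] E), ∀ i, U (b i) = w i • b i := by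
  obtain ⟨e⟩ : Nonempty (τ ↪ Fin (Module.finrank ℂ E)) :=
    Function.Embedding.nonempty_of_card_le (by simpa using hcard)
  have hw (i) : ‖Function.extend e z 1 i‖ = 1 := by
    by_cases hi : ∃ t, e t = i
    · obtain ⟨t, rfl⟩ := hi
      rw [e.injective.extend_apply, hz]
    · rw [Function.extend_apply' _ _ _ hi, Pi.one_apply, norm_one]
  exact ⟨stdOrthonormalBasis ℂ E, Function.extend e z 1, e, e.injective.extend_apply z 1,
    exists_mem_unitary_apply_eq_smul _ hw⟩

theorem norm_sum_mul_le_of_eigenbasis {ι κ : Type*} [Fintype ι] [Fintype κ] [DecidableEq κ]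
    (ψ : ℂ → ℂ → ℂ → ℂ) {U : E →L[ℂ] E} {b : OrthonormalBasis ι ℂ E} {z : ι → ℂ}
    (hU : ∀ i, U (b i) = z i • b i) {o : ι} {p q : κ → ι} (hp : Function.Injective p)
    (hq : Function.Injective q) (hpo : ∀ k, p k ≠ o) (hqo : ∀ k, q k ≠ o) {u : E} {s : ℝ}
    (hup : ∀ k, inner ℂ (b (p k)) u = s) (huq : ∀ k, inner ℂ (b (q k)) u = s)
    (K : Matrix κ κ ℂ) :
    s ^ 2 * ‖∑ k, ∑ l, K k l * (ψ (z (p k)) (z o) (z (q l)) * z o * z (q l))‖ ≤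
      ‖K‖ * schattenNorm 1 (tripleOperatorIntegral ψ U U U (symmRankTwo (b o) u * U)
        (symmRankTwo (b o) u * U)) := by
  have huq' (k : κ) : inner ℂ u (b (q k)) = s := by
    rw [← inner_conj_symm, huq, Complex.conj_ofReal]
  refine le_of_eq_of_le ?_ (norm_sum_mul_inner_le (b.orthonormal.comp p hp)
    (b.orthonormal.comp q hq) K _)
  rw [← Real.norm_of_nonneg (sq_nonneg s), ← Complex.norm_real, ← norm_mul, Finset.mul_sum]
  refine congrArg norm <| Finset.sum_congr rfl fun k _ => ?_
  rw [Finset.mul_sum]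
  refine Finset.sum_congr rfl fun l _ => ?_
  rw [Function.comp_apply, Function.comp_apply,
    inner_tripleOperatorIntegral_symmRankTwo_mul ψ b hU u (hpo k) (hqo l), hup, huq']
  push_cast
  ring

theorem exists_norm_sum_le_schattenNorm_one {κ : Type*} [Fintype κ] [DecidableEq κ] [Nonempty κ]
    (hcard : 2 * Fintype.card κ + 1 ≤ Module.finrank ℂ E) (ψ : ℂ → ℂ → ℂ → ℂ) (K : Matrix κ κ ℂ)
    {z₀ : ℂ} {α β : κ → ℂ} (hz₀ : ‖z₀‖ = 1) (hα : ∀ k, ‖α k‖ = 1) (hβ : ∀ k, ‖β k‖ = 1) :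
    ∃ W U : E →L[ℂ] E, IsSelfAdjoint W ∧ schattenNorm 2 W ≤ 1 ∧ U ∈ unitary (E →L[ℂ] E) ∧
      ‖∑ k, ∑ l, K k l * (ψ (α k) z₀ (β l) * z₀ * β l)‖ ≤ 4 * Fintype.card κ *
        (‖K‖ * schattenNorm 1 (tripleOperatorIntegral ψ U U U (W * U) (W * U))) := by
  have hcard' : Fintype.card (Option (κ ⊕ κ)) ≤ Module.finrank ℂ E := by
    simpa [two_mul] using hcard
  obtain ⟨b, z, e, hz, U, hUmem, hU⟩ := exists_unitary_eigenbasis hcard'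
    (z := fun t => t.elim z₀ (Sum.elim α β)) (by rintro (_ | _ | _) <;> simp [hz₀, hα, hβ])
  have hsome : Function.Injective fun x : κ ⊕ κ => e (some x) :=
    e.injective.comp (Option.some_injective _)
  have hv : Orthonormal ℂ fun x : κ ⊕ κ => b (e (some x)) := b.orthonormal.comp _ hsome
  let s : ℝ := √((4 * Fintype.card κ)⁻¹)
  have hs : s ^ 2 = (4 * Fintype.card κ : ℝ)⁻¹ := Real.sq_sqrt (by positivity)
  let u : E := ∑ x : κ ⊕ κ, (s : ℂ) • b (e (some x))
  have hinner (x : κ ⊕ κ) : inner ℂ (b (e (some x))) u = s := hv.inner_right_fintype _ x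
  have horth : inner ℂ (b (e none)) u = 0 := by
    simp [u, b.inner_eq_ite]
  have hu : ‖u‖ ^ 2 = 1 / 2 := by
    refine (congrArg (· ^ 2) (norm_sum_smul_of_orthonormal hv (.toLp 2 fun _ => (s : ℂ)))).trans ?_
    simp only [EuclideanSpace.norm_sq_eq, Complex.norm_real, Real.norm_eq_abs, sq_abs, hs,
      Finset.sum_const, Finset.card_univ, Fintype.card_sum, nsmul_eq_mul, Nat.cast_add]
    field_simp
    norm_num
  refine ⟨symmRankTwo (b (e none)) u, U, isSelfAdjoint_symmRankTwo _ _, ?_, hUmem, ?_⟩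
  · rw [schattenNorm_two_symmRankTwo horth, b.norm_eq_one, one_mul, ← Real.sqrt_sq (norm_nonneg u),
      hu, ← Real.sqrt_mul zero_le_two, mul_one_div_cancel two_ne_zero, Real.sqrt_one]
  · have hbound := norm_sum_mul_le_of_eigenbasis ψ hU (hsome.comp Sum.inl_injective)
      (hsome.comp Sum.inr_injective) (by simp) (by simp) (fun k => hinner (.inl k))
      (fun k => hinner (.inr k)) (o := e none) K
    rw [hs, inv_mul_le_iff₀ (by positivity)] at hbound
    simpa [hz] using hbound

end TripleOperatorIntegral

section DividedDifferences

theorem injOn_exp_mul_I :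
    Set.InjOn (fun x : ℝ => Complex.exp (x * Complex.I)) (Set.Ioc (-Real.pi) Real.pi) := by
  have harg {x : ℝ} (hx : x ∈ Set.Ioc (-Real.pi) Real.pi) :
      (Complex.exp (x * Complex.I)).arg = x := by
    rw [Complex.exp_mul_I, Complex.arg_cos_add_sin_mul_I hx]
  intro x hx y hy hxy
  exact (harg hx).symm.trans ((congrArg Complex.arg hxy).trans (harg hy))

theorem exp_mul_I_sub_exp_mul_I (x y : ℂ) :
    Complex.exp (x * Complex.I) - Complex.exp (y * Complex.I)
      = 2 * Complex.I * Complex.sin ((x - y) / 2) *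
        (Complex.exp (x / 2 * Complex.I) * Complex.exp (y / 2 * Complex.I)) := by
  have hsin : 2 * Complex.I * Complex.sin ((x - y) / 2) = Complex.exp ((x - y) / 2 * Complex.I)
      - Complex.exp (-((x - y) / 2) * Complex.I) := by
    rw [Complex.sin]
    linear_combination (Complex.exp (-((x - y) / 2) * Complex.I)
      - Complex.exp ((x - y) / 2 * Complex.I)) * Complex.I_sq
  rw [hsin, sub_mul, ← Complex.exp_add, ← Complex.exp_add, ← Complex.exp_add]
  congr 2 <;> ring

theorem exp_mul_exp_mul_dividedDiff₁ (g : ℂ → ℂ) {x y : ℂ}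
    (hxy : Complex.exp (x * Complex.I) ≠ Complex.exp (y * Complex.I)) :
    Complex.I * (Complex.exp (x / 2 * Complex.I) * Complex.exp (y / 2 * Complex.I)) *
        dividedDiff₁ g (Complex.exp (x * Complex.I)) (Complex.exp (y * Complex.I))
      = (g (Complex.exp (x * Complex.I)) - g (Complex.exp (y * Complex.I))) /
        (2 * Complex.sin ((x - y) / 2)) := by
  rw [dividedDiff₁, if_neg hxy, exp_mul_I_sub_exp_mul_I]
  field_simp [Complex.exp_ne_zero, Complex.I_ne_zero]

theorem dividedDiff₂_sub_mul (g : ℂ → ℂ) {a z w : ℂ} (hz : z ≠ a) (hw : w ≠ a) (hzw : z ≠ w) :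
    dividedDiff₂ (fun z => (z - a) * g z) z a w = dividedDiff₁ g z w := by
  have hza : z - a ≠ 0 := sub_ne_zero.2 hz
  have haw : a - w ≠ 0 := sub_ne_zero.2 hw.symm
  rw [dividedDiff₂, if_neg hzw, dividedDiff₁, if_neg hz, dividedDiff₁, if_neg hw.symm,
    dividedDiff₁, if_neg hzw]
  congr 2
  · rw [sub_self, zero_mul, sub_zero, mul_div_cancel_left₀ _ hza]
  · rw [sub_self, zero_mul, zero_sub, ← neg_mul, neg_sub, mul_div_cancel_left₀ _ haw]

end DividedDifferences

section Symbol

/-- The angles `e^{-(k+1)}` at which the function `h₀` is sampled. -/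
def angle (k : ℕ) : ℝ := Real.exp (-((k : ℝ) + 1))

theorem angle_pos (k : ℕ) : 0 < angle k := Real.exp_pos _

theorem angle_le_exp_neg_one (k : ℕ) : angle k ≤ Real.exp (-1) :=
  Real.exp_le_exp.2 (by linarith [k.cast_nonneg (α := ℝ)])

theorem angle_le_one (k : ℕ) : angle k ≤ 1 :=
  (angle_le_exp_neg_one k).trans (Real.exp_le_one_iff.2 (by norm_num))

theorem angle_mem_Ioc (k : ℕ) : angle k ∈ Set.Ioc (-Real.pi) Real.pi :=
  ⟨by linarith [angle_pos k, Real.pi_pos], by linarith [angle_le_one k, Real.pi_gt_three]⟩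

theorem neg_angle_mem_Ioc (k : ℕ) : -angle k ∈ Set.Ioc (-Real.pi) Real.pi :=
  ⟨by linarith [angle_le_one k, Real.pi_gt_three], by linarith [angle_pos k, Real.pi_pos]⟩

theorem two_mul_angle_le {k l : ℕ} (h : k < l) : 2 * angle l ≤ angle k := by
  have hkl : (k : ℝ) + 1 ≤ l := by exact_mod_cast h
  calc 2 * angle l ≤ Real.exp 1 * angle l := by
        gcongr
        · exact (angle_pos l).le
        · linarith [Real.exp_one_gt_d9]
    _ ≤ angle k := by
        rw [angle, angle, ← Real.exp_add, Real.exp_le_exp]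
        linarith

/-- The factor `(log (k + 2))^{-1/2}` of `h₀` at `± angle k`. -/
def weight (k : ℕ) : ℝ := Real.log (k + 2) ^ (-(1 / 2) : ℝ)

theorem weight_pos (k : ℕ) : 0 < weight k :=
  Real.rpow_pos_of_pos (Real.log_pos (by linarith [k.cast_nonneg (α := ℝ)])) _

theorem weight_antitone : Antitone weight := fun k l hkl =>
  Real.rpow_le_rpow_of_nonpos (Real.log_pos (by linarith [k.cast_nonneg (α := ℝ)]))
    (by gcongr) (by norm_num)

theorem h₀_of_abs_eq_angle {x : ℝ} {k : ℕ} (hx : |x| = angle k) : h₀ x = weight k * angle k := by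
  have hlog : |Real.log (angle k / Real.exp 1)| = k + 2 := by
    rw [angle, ← Real.exp_sub, Real.log_exp, abs_of_neg (by linarith [k.cast_nonneg (α := ℝ)])]
    ring
  rw [h₀, if_neg (abs_pos.1 (hx ▸ angle_pos k)), hx, hlog, weight, mul_comm]

theorem half_mul_log_rpow_le_weight_mul_log (n : ℕ) :
    1 / 2 * Real.log n ^ (1 / 2 : ℝ) ≤ weight n * Real.log n := by
  obtain hn | hn := lt_or_ge n 2
  · interval_cases n <;> simp
  have hn' : (2 : ℝ) ≤ n := by exact_mod_cast hn
  have hlog : Real.log (n + 2) ≤ 2 ^ 2 * Real.log n :=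
    calc Real.log (n + 2) ≤ Real.log ((n : ℝ) ^ 4) :=
          Real.log_le_log (by linarith) (by nlinarith [sq_nonneg ((n : ℝ) ^ 2 - 1)])
      _ = 2 ^ 2 * Real.log n := by
          rw [Real.log_pow]
          norm_num
  rw [weight, Real.rpow_neg (Real.log_nonneg (by linarith)),
    le_inv_mul_iff₀ (Real.rpow_pos_of_pos (Real.log_pos (by linarith)) _), ← Real.sqrt_eq_rpow,
    ← Real.sqrt_eq_rpow]
  calc √(Real.log (n + 2)) * (1 / 2 * √(Real.log n))
      ≤ √(2 ^ 2 * Real.log n) * (1 / 2 * √(Real.log n)) := by gcongr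
    _ = √(Real.log n) * √(Real.log n) := by
        rw [Real.sqrt_mul (by norm_num), Real.sqrt_sq zero_le_two]
        ring
    _ = Real.log n := Real.mul_self_sqrt (Real.log_nonneg (by linarith))

/-- The divided difference, stripped of its phase, at `e^{i angle k}`, `e^{-i angle l}` of a
function on the circle whose value at `e^{ix}` is `h₀ x`. -/
def symbol (k l : ℕ) : ℝ :=
  (weight k * angle k - weight l * angle l) / (2 * Real.sin ((angle k + angle l) / 2))

theorem symbol_swap (k l : ℕ) : symbol l k = -symbol k l := by
  rw [symbol, symbol, add_comm (angle l), ← neg_div, neg_sub]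

theorem weight_div_three_le_symbol {k l : ℕ} (hkl : k < l) : weight k / 3 ≤ symbol k l := by
  have hk := angle_pos k
  have hl := angle_pos l
  have hsin_pos : 0 < Real.sin ((angle k + angle l) / 2) :=
    Real.sin_pos_of_pos_of_lt_pi (by linarith)
      (by linarith [angle_le_one k, angle_le_one l, Real.pi_gt_three])
  have hsin_le : Real.sin ((angle k + angle l) / 2) ≤ (angle k + angle l) / 2 :=
    Real.sin_le (by linarith)
  rw [symbol, le_div_iff₀ (by positivity)]
  calc weight k / 3 * (2 * Real.sin ((angle k + angle l) / 2))
      ≤ weight k / 3 * (angle k + angle l) := by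
        gcongr
        · linarith [weight_pos k]
        · linarith
    _ ≤ weight k * angle k - weight k * angle l := by
        linarith [mul_le_mul_of_nonneg_left (two_mul_angle_le hkl) (weight_pos k).le]
    _ ≤ weight k * angle k - weight l * angle l := by
        gcongr
        exact weight_antitone hkl.le

theorem weight_div_three_mul_le_inv_mul_symbol {n k l : ℕ} (hk : k ≤ n) (hl : l ≤ n) :
    weight n / 3 * |(l : ℝ) - k|⁻¹ ≤ ((l : ℝ) - k)⁻¹ * symbol k l := by
  wlog hkl : k ≤ l generalizing k l
  · rw [abs_sub_comm, symbol_swap, mul_neg, ← neg_mul, ← inv_neg, neg_sub]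
    exact this hl hk (le_of_not_ge hkl)
  obtain rfl | hlt := hkl.eq_or_lt
  · simp
  · rw [abs_of_nonneg (sub_nonneg.2 (Nat.cast_le.2 hkl)), mul_comm]
    refine mul_le_mul_of_nonneg_left ?_ (inv_nonneg.2 (sub_nonneg.2 (Nat.cast_le.2 hkl)))
    linarith [weight_antitone hk, weight_div_three_le_symbol hlt]

theorem log_le_sum_inv_abs_sub {n k : ℕ} (hk : k < n) :
    Real.log n ≤ ∑ l ∈ Finset.range n, |(l : ℝ) - k|⁻¹ := by
  obtain ⟨m, rfl⟩ := Nat.exists_eq_add_of_lt hk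
  have hleft : ∑ l ∈ Finset.range k, |(l : ℝ) - k|⁻¹ = harmonic k := by
    rw [harmonic, ← Finset.sum_range_reflect, Rat.cast_sum]
    refine Finset.sum_congr rfl fun l hl => ?_
    obtain ⟨j, rfl⟩ := Nat.exists_eq_add_of_lt (Finset.mem_range.1 hl)
    rw [show l + j + 1 - 1 - l = j by omega, abs_sub_comm]
    push_cast
    rw [abs_of_nonneg (by linarith [j.cast_nonneg (α := ℝ)])]
    ring
  have hright : ∑ j ∈ Finset.range (m + 1), |((k + j : ℕ) : ℝ) - k|⁻¹ = harmonic m := by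
    simp only [Nat.cast_add, add_sub_cancel_left, Nat.abs_cast]
    simp [Finset.sum_range_succ', harmonic]
  calc Real.log (k + m + 1 : ℕ) ≤ Real.log (((k + 1 : ℕ) : ℝ) * ((m + 1 : ℕ) : ℝ)) := by
        refine Real.log_le_log (by positivity) ?_
        exact_mod_cast (by nlinarith : k + m + 1 ≤ (k + 1) * (m + 1))
    _ = Real.log (k + 1 : ℕ) + Real.log (m + 1 : ℕ) := Real.log_mul (by positivity) (by positivity)
    _ ≤ harmonic k + harmonic m :=
        add_le_add (log_add_one_le_harmonic k) (log_add_one_le_harmonic m)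
    _ = _ := by rw [add_assoc, Finset.sum_range_add, hleft, hright]

theorem le_sum_inv_mul_symbol (n : ℕ) :
    n * (weight n / 3 * Real.log n)
      ≤ ∑ k : Fin n, ∑ l : Fin n, ((l : ℝ) - k)⁻¹ * symbol k l := by
  have hrow (k : Fin n) :
      weight n / 3 * Real.log n ≤ ∑ l : Fin n, ((l : ℝ) - k)⁻¹ * symbol k l :=
    calc weight n / 3 * Real.log n ≤ weight n / 3 * ∑ l : Fin n, |(l : ℝ) - k|⁻¹ := by
          rw [← Finset.sum_range fun l : ℕ => |(l : ℝ) - k|⁻¹]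
          exact mul_le_mul_of_nonneg_left (log_le_sum_inv_abs_sub k.2)
            (by linarith [weight_pos n])
      _ ≤ ∑ l : Fin n, ((l : ℝ) - k)⁻¹ * symbol k l := by
          rw [Finset.mul_sum]
          exact Finset.sum_le_sum fun l _ =>
            weight_div_three_mul_le_inv_mul_symbol k.2.le l.2.le
  simpa using Finset.card_nsmul_le_sum Finset.univ _ _ fun k _ => hrow k

end Symbol

section PhasedKernel

open scoped Matrix.Norms.L2Operator

theorem l2_opNorm_diagonal_mul_mul_diagonal_le {𝕜 κ ι : Type*} [RCLike 𝕜] [Fintype κ]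
    [DecidableEq κ] [Fintype ι] [DecidableEq ι] (K : Matrix κ ι 𝕜) {x : κ → 𝕜} {y : ι → 𝕜}
    (hx : ∀ k, ‖x k‖ ≤ 1) (hy : ∀ l, ‖y l‖ ≤ 1) :
    ‖Matrix.diagonal x * K * Matrix.diagonal y‖ ≤ ‖K‖ := by
  have hx' : ‖Matrix.diagonal x‖ ≤ 1 := by
    rwa [Matrix.l2_opNorm_diagonal, pi_norm_le_iff_of_nonneg zero_le_one]
  have hy' : ‖Matrix.diagonal y‖ ≤ 1 := by
    rwa [Matrix.l2_opNorm_diagonal, pi_norm_le_iff_of_nonneg zero_le_one]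
  calc _ ≤ ‖Matrix.diagonal x‖ * ‖K‖ * ‖Matrix.diagonal y‖ :=
        (Matrix.l2_opNorm_mul _ _).trans <|
          mul_le_mul_of_nonneg_right (Matrix.l2_opNorm_mul _ _) (norm_nonneg _)
    _ ≤ 1 * ‖K‖ * 1 := by gcongr
    _ = ‖K‖ := by ring

/-- The Hilbert matrix, multiplied by the phases that turn the divided differences
`g^{[1]}(e^{i angle k}, e^{-i angle l}) e^{-i angle l}` into the real numbers `symbol k l`. -/
def phasedHilbertMatrix (n : ℕ) : Matrix (Fin n) (Fin n) ℂ :=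
  Matrix.diagonal (fun k : Fin n => Complex.I * Complex.exp ((angle k / 2 : ℝ) * Complex.I)) *
    hilbertMatrix n *
    Matrix.diagonal fun l : Fin n => Complex.exp ((angle l / 2 : ℝ) * Complex.I)

theorem l2_opNorm_phasedHilbertMatrix_le (n : ℕ) : ‖phasedHilbertMatrix n‖ ≤ Real.pi := by
  refine (l2_opNorm_diagonal_mul_mul_diagonal_le _ (fun k => ?_) fun l => ?_).trans
    (l2_opNorm_hilbertMatrix_le n)
  · rw [norm_mul, Complex.norm_I, Complex.norm_exp_ofReal_mul_I, one_mul]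
  · rw [Complex.norm_exp_ofReal_mul_I]

theorem phasedHilbertMatrix_apply {n : ℕ} (k l : Fin n) :
    phasedHilbertMatrix n k l = Complex.I * (Complex.exp ((angle k / 2 : ℝ) * Complex.I) *
      Complex.exp ((angle l / 2 : ℝ) * Complex.I)) * ((l : ℂ) - k)⁻¹ := by
  rw [phasedHilbertMatrix, Matrix.mul_diagonal, Matrix.diagonal_mul, hilbertMatrix, Matrix.of_apply]
  ring

theorem exp_angle_ne_exp_neg_angle (k l : ℕ) :
    Complex.exp (angle k * Complex.I) ≠ Complex.exp ((-angle l : ℝ) * Complex.I) :=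
  injOn_exp_mul_I.ne (angle_mem_Ioc k) (neg_angle_mem_Ioc l)
    (by linarith [angle_pos k, angle_pos l])

theorem dividedDiff₂_sub_one_mul_exp_angle (g : ℂ → ℂ) (k l : ℕ) :
    dividedDiff₂ (fun z => (z - 1) * g z) (Complex.exp (angle k * Complex.I)) 1
        (Complex.exp ((-angle l : ℝ) * Complex.I))
      = dividedDiff₁ g (Complex.exp (angle k * Complex.I))
        (Complex.exp ((-angle l : ℝ) * Complex.I)) := by
  have hne {x : ℝ} (hx : x ∈ Set.Ioc (-Real.pi) Real.pi) (hx0 : x ≠ 0) :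
      Complex.exp (x * Complex.I) ≠ 1 := by
    simpa using injOn_exp_mul_I.ne hx ⟨neg_lt_zero.2 Real.pi_pos, Real.pi_pos.le⟩ hx0
  exact dividedDiff₂_sub_mul g (hne (angle_mem_Ioc k) (angle_pos k).ne')
    (hne (neg_angle_mem_Ioc l) (neg_ne_zero.2 (angle_pos l).ne')) (exp_angle_ne_exp_neg_angle k l)

theorem phasedHilbertMatrix_mul_dividedDiff₂ {g : ℂ → ℂ}
    (hg : ∀ x ∈ Set.Icc (-Real.exp (-1)) (Real.exp (-1)), g (Complex.exp (x * Complex.I)) = h₀ x)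
    {n : ℕ} (k l : Fin n) :
    phasedHilbertMatrix n k l * (dividedDiff₂ (fun z => (z - 1) * g z)
        (Complex.exp (angle k * Complex.I)) 1 (Complex.exp ((-angle l : ℝ) * Complex.I)) *
        1 * Complex.exp ((-angle l : ℝ) * Complex.I))
      = (((l : ℝ) - k)⁻¹ * symbol k l : ℝ) := by
  have hgk : g (Complex.exp (angle k * Complex.I)) = (weight k * angle k : ℝ) := by
    rw [hg _ ⟨by linarith [angle_pos k, Real.exp_pos (-1)], angle_le_exp_neg_one k⟩,
      h₀_of_abs_eq_angle (abs_of_pos (angle_pos k))]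
  have hgl : g (Complex.exp ((-angle l : ℝ) * Complex.I)) = (weight l * angle l : ℝ) := by
    rw [hg _ ⟨by linarith [angle_le_exp_neg_one l], by linarith [angle_pos l, Real.exp_pos (-1)]⟩,
      h₀_of_abs_eq_angle ((abs_neg _).trans (abs_of_pos (angle_pos l)))]
  have hphase : Complex.exp ((-angle l : ℝ) / 2 * Complex.I) =
      Complex.exp ((angle l / 2 : ℝ) * Complex.I) *
        Complex.exp ((-angle l : ℝ) * Complex.I) := by
    rw [← Complex.exp_add]
    congr 1
    push_cast
    ring
  have hsymbol := exp_mul_exp_mul_dividedDiff₁ g (exp_angle_ne_exp_neg_angle k l)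
  rw [hphase, hgk, hgl] at hsymbol
  rw [dividedDiff₂_sub_one_mul_exp_angle, phasedHilbertMatrix_apply, symbol]
  push_cast at hsymbol ⊢
  rw [sub_neg_eq_add] at hsymbol
  rw [← hsymbol]
  ring

theorem le_norm_sum_phasedHilbertMatrix_mul_dividedDiff₂ {g : ℂ → ℂ}
    (hg : ∀ x ∈ Set.Icc (-Real.exp (-1)) (Real.exp (-1)), g (Complex.exp (x * Complex.I)) = h₀ x)
    (n : ℕ) :
    n * (weight n / 3 * Real.log n)
      ≤ ‖∑ k : Fin n, ∑ l : Fin n, phasedHilbertMatrix n k l *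
          (dividedDiff₂ (fun z => (z - 1) * g z)
            (Complex.exp (angle k * Complex.I)) 1 (Complex.exp ((-angle l : ℝ) * Complex.I)) *
            1 * Complex.exp ((-angle l : ℝ) * Complex.I))‖ := by
  simp only [phasedHilbertMatrix_mul_dividedDiff₂ hg, ← Complex.ofReal_sum, Complex.norm_real]
  exact (le_sum_inv_mul_symbol n).trans (Real.le_norm_self _)

end PhasedKernel

end PellerUnitary

end

theorem corollary4p6_general {E : Type*} [NormedAddCommGroup E] [InnerProductSpace ℂ E]
    [FiniteDimensional ℂ E] {g : ℂ → ℂ}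
    (hg : ∀ x ∈ Set.Icc (-Real.exp (-1)) (Real.exp (-1)),
      g (Complex.exp (x * Complex.I)) = PellerUnitary.h₀ x)
    {n : ℕ} (hn : n ≠ 0) (hE : 2 * n + 1 ≤ Module.finrank ℂ E) :
    ∃ W U : E →L[ℂ] E, IsSelfAdjoint W ∧ PellerUnitary.schattenNorm 2 W ≤ 1 ∧
      U ∈ unitary (E →L[ℂ] E) ∧
      1 / (24 * Real.pi) * Real.log n ^ (1 / 2 : ℝ) ≤
        PellerUnitary.schattenNorm 1
          (PellerUnitary.tripleOperatorIntegral
            (PellerUnitary.dividedDiff₂ fun z => (z - 1) * g z) U U U (W * U) (W * U)) := by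
  have : NeZero n := ⟨hn⟩
  obtain ⟨W, U, hW, hWnorm, hU, hle⟩ :=
    PellerUnitary.exists_norm_sum_le_schattenNorm_one (κ := Fin n) (by simpa using hE)
      (PellerUnitary.dividedDiff₂ fun z => (z - 1) * g z) (PellerUnitary.phasedHilbertMatrix n)
      norm_one (fun k => Complex.norm_exp_ofReal_mul_I (PellerUnitary.angle k))
      fun l => Complex.norm_exp_ofReal_mul_I (-PellerUnitary.angle l)
  refine ⟨W, U, hW, hWnorm, hU, ?_⟩
  set S := PellerUnitary.schattenNorm 1
    (PellerUnitary.tripleOperatorIntegral _ U U U (W * U) (W * U))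
  have hbound : n * (PellerUnitary.weight n / 3 * Real.log n) ≤ n * (4 * (Real.pi * S)) :=
    calc _ ≤ _ := PellerUnitary.le_norm_sum_phasedHilbertMatrix_mul_dividedDiff₂ hg n
      _ ≤ _ := hle
      _ ≤ 4 * n * (Real.pi * S) := by
        rw [Fintype.card_fin]
        gcongr
        exacts [PellerUnitary.schattenNorm_nonneg _ _,
          PellerUnitary.l2_opNorm_phasedHilbertMatrix_le n]
      _ = _ := by ring
  rw [one_div_mul_eq_div, div_le_iff₀ (by positivity)]
  linarith [le_of_mul_le_mul_left hbound (by positivity),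
    PellerUnitary.half_mul_log_rpow_le_weight_mul_log n]

theorem corollary4p6 (h : ℝ → ℝ) (hh : PellerUnitary.IsAdmissible h) :
    ∃ c : ℝ, 0 < c ∧ ∀ n : ℕ, 3 ≤ n →
      ∃ W U : EuclideanSpace ℂ (Fin (8 * n + 4)) →L[ℂ] EuclideanSpace ℂ (Fin (8 * n + 4)),
        IsSelfAdjoint W ∧ PellerUnitary.schattenNorm 2 W ≤ 1 ∧
        U ∈ unitary (EuclideanSpace ℂ (Fin (8 * n + 4)) →L[ℂ]
          EuclideanSpace ℂ (Fin (8 * n + 4))) ∧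
        c * Real.log n ^ (1 / 2 : ℝ) ≤
          PellerUnitary.schattenNorm 1
            (PellerUnitary.tripleOperatorIntegral
              (PellerUnitary.dividedDiff₂ (PellerUnitary.fFun h)) U U U (W * U) (W * U)) := by
  exact ⟨1 / (24 * Real.pi), by positivity, fun n hn => corollary4p6_general
    (fun x hx => by rw [PellerUnitary.circleFun_exp hh.periodic, hh.eq_h₀ x hx]) (by omega)
    (by rw [finrank_euclideanSpace_fin]; omega)⟩
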